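/- Let $G$ be a finite simple connected graph (no loops, no multiple edges) with at least $2$ vertices, and let $s$ be the number of vertices of $G$ whose degree is not $2$. Then $G$ has a spanning tree with at least $\frac14(s-2)+2$ leaves, where a leaf of a tree is a vertex of degree $1$ in that tree. -/

import Mathlib

open Classical in
/-- The number of leaves (vertices of degree one) of a graph on a finite vertex set. -/
noncomputable def numLeaves {V : Type*} [Fintype V] (T : SimpleGraph V) : ℕ :=
  (Finset.univ.filter fun v : V => T.degree v = 1).card

open Classical in
/-- The number of vertices whose degree is not two. -/
noncomputable def numDegNeTwo {V : Type*} [Fintype V] (G : SimpleGraph V) : ℕ :=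
  (Finset.univ.filter fun v : V => G.degree v ≠ 2).card

/-- `T` is a spanning tree of `G`: a tree on all vertices of `G` whose edges are edges of `G`. -/
def IsSpanningTree {V : Type*} (T G : SimpleGraph V) : Prop :=
  T ≤ G ∧ T.IsTree

/-!
The proof grows a subtree by fully expanding one vertex at a time and charges the vertices of degree
different from two to leaves and to *dead* leaves, as Kleitman and West did for minimum degree three.

The growing tree is recorded only through the connected set `I` of its expanded vertices. The tree
covers the closed neighbourhood `N[I]`, and its leaves form the frontier `N[I] \ I`. A frontier
vertex is dead if all its neighbours lie in `N[I]`. The potential is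
`3 * #leaves + #dead leaves - #{v ∈ N[I] | deg v ≠ 2}`. As long as `N[I]` is not everything, `I` can
be enlarged without decreasing the potential (`exists_ssuperset_potential_le`): expanding a frontier
vertex with `k ≥ 1` outside neighbours changes the potential by at least `2 * k - 3`. So `k ≥ 2` is
fine. If every frontier vertex has at most one outside neighbour, let `x` be one of these outside
neighbours. When `x` itself sees at least two vertices outside, expanding its parent and then `x`
gains at least `-1 + 1 = 0`. Otherwise only `x` is added, and either it has degree two and costs
nothing, or it has degree one and is dead at once, or its degree is at least three and another
frontier vertex, whose only outside neighbour was `x`, dies.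

Once `N[I]` is the whole vertex set, all leaves are dead and the potential is `4 * #leaves - s`. All
vertices outside `I` can be made leaves of one spanning tree (`exists_isSpanningTree_card_compl_le`).
Starting from a single vertex of degree `d` the potential is at least `2 * d - 1`, while
`4 * #leaves - s ≥ 6` is needed. This suffices for `d ≥ 4`. If the maximum degree is three,
the potential is at least five, and `s` is the number of vertices of odd degree, hence even, so five
improves to six. If no degree exceeds two, counting edges gives `s ≤ 2`, and two leaves are enough.
-/

open scoped Finset

namespace SimpleGraph

section Potential

open scoped Classical

variable {V : Type*} [Fintype V] {G : SimpleGraph V} {I : Finset V} {v x : V}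

/-! ### Closed neighbourhoods, outside neighbours, dead vertices -/

variable (G I) in
/-- The closed neighbourhood `N[I]`: the vertices in `I` or adjacent to a vertex of `I`. -/
noncomputable def closedNbhd : Finset V :=
  {v | v ∈ I ∨ ∃ a ∈ I, G.Adj a v}

variable (G I v) in
/-- The neighbours of `v` outside the closed neighbourhood of `I`. -/
noncomputable def outsideNbrs : Finset V :=
  G.neighborFinset v \ closedNbhd G I

variable (G I) in
/-- The vertices outside `I` with a neighbour in `I`: the leaves of a tree with interior `I` that
covers `N[I]`. -/
noncomputable def frontier : Finset V :=
  closedNbhd G I \ I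

variable (G I) in
/-- The dead leaves: the frontier vertices all of whose neighbours lie in `N[I]`. -/
noncomputable def deadLeaves : Finset V :=
  {v ∈ frontier G I | outsideNbrs G I v = ∅}

variable (G I) in
/-- Three times the number of leaves, plus the number of dead leaves, minus the number of covered
vertices whose degree is not two. -/
noncomputable def potential : ℤ :=
  3 * #(frontier G I) + #(deadLeaves G I) - #{v ∈ closedNbhd G I | G.degree v ≠ 2}

lemma mem_closedNbhd : v ∈ closedNbhd G I ↔ v ∈ I ∨ ∃ a ∈ I, G.Adj a v := by
  simp [closedNbhd]

lemma mem_outsideNbrs : x ∈ outsideNbrs G I v ↔ G.Adj v x ∧ x ∉ closedNbhd G I := by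
  simp [outsideNbrs]

lemma mem_frontier : v ∈ frontier G I ↔ v ∈ closedNbhd G I ∧ v ∉ I := by
  simp [frontier]

lemma mem_deadLeaves :
    v ∈ deadLeaves G I ↔ v ∈ frontier G I ∧ outsideNbrs G I v = ∅ := by
  simp [deadLeaves]

lemma subset_closedNbhd : I ⊆ closedNbhd G I := fun _ h => mem_closedNbhd.2 (.inl h)

lemma disjoint_closedNbhd_outsideNbrs : Disjoint (closedNbhd G I) (outsideNbrs G I v) :=
  Finset.disjoint_sdiff

lemma outsideNbrs_eq_empty_of_mem (hv : v ∈ I) : outsideNbrs G I v = ∅ := by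
  ext x
  simp only [mem_outsideNbrs, mem_closedNbhd, Finset.notMem_empty, iff_false]
  exact fun ⟨h, h'⟩ => h' (.inr ⟨v, hv, h⟩)

lemma closedNbhd_insert (hv : v ∈ frontier G I) :
    closedNbhd G (insert v I) = closedNbhd G I ∪ outsideNbrs G I v := by
  ext x
  have := (mem_frontier.1 hv).1
  simp only [mem_closedNbhd, mem_outsideNbrs, Finset.mem_insert, Finset.mem_union] at *
  grind

lemma frontier_insert (hv : v ∈ frontier G I) :
    frontier G (insert v I) = (frontier G I).erase v ∪ outsideNbrs G I v := by
  ext x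
  have h1 : x ∈ outsideNbrs G I v → x ∉ I := fun h h' =>
    (mem_outsideNbrs.1 h).2 (subset_closedNbhd h')
  have h2 : x ∈ outsideNbrs G I v → x ≠ v := fun h => (mem_outsideNbrs.1 h).1.ne'
  rw [mem_frontier, closedNbhd_insert hv]
  simp only [Finset.mem_insert, Finset.mem_union, Finset.mem_erase, mem_frontier]
  tauto

lemma card_frontier_insert (hv : v ∈ frontier G I) :
    (#(frontier G (insert v I)) : ℤ) = #(frontier G I) - 1 + #(outsideNbrs G I v) := by
  rw [frontier_insert hv, Finset.card_union_of_disjoint, Finset.card_erase_of_mem hv]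
  · have : 0 < #(frontier G I) := Finset.card_pos.2 ⟨v, hv⟩
    omega
  · refine disjoint_closedNbhd_outsideNbrs.mono_left fun x hx => ?_
    exact (mem_frontier.1 (Finset.mem_of_mem_erase hx)).1

lemma outsideNbrs_insert (hv : v ∈ frontier G I) :
    outsideNbrs G (insert v I) x = outsideNbrs G I x \ outsideNbrs G I v := by
  ext y
  rw [Finset.mem_sdiff, mem_outsideNbrs, mem_outsideNbrs (v := x), closedNbhd_insert hv,
    Finset.mem_union]
  tauto

lemma deadLeaves_subset_insert (hv : v ∈ frontier G I) (h : (outsideNbrs G I v).Nonempty) :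
    deadLeaves G I ⊆ deadLeaves G (insert v I) := by
  intro x hx
  obtain ⟨hx, hx'⟩ := mem_deadLeaves.1 hx
  have hne : x ≠ v := by rintro rfl; simp [hx'] at h
  rw [mem_deadLeaves, frontier_insert hv, outsideNbrs_insert hv, hx']
  simp [hx, hne]

lemma card_degree_ne_two_insert (hv : v ∈ frontier G I) :
    #{x ∈ closedNbhd G (insert v I) | G.degree x ≠ 2} =
      #{x ∈ closedNbhd G I | G.degree x ≠ 2} + #{x ∈ outsideNbrs G I v | G.degree x ≠ 2} := by
  rw [closedNbhd_insert hv, Finset.filter_union, Finset.card_union_of_disjoint]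
  exact Finset.disjoint_filter_filter disjoint_closedNbhd_outsideNbrs

/-! ### Expanding vertices without decreasing the potential -/

lemma potential_insert_ge (hv : v ∈ frontier G I) (h : (outsideNbrs G I v).Nonempty) :
    potential G I + (2 * #(outsideNbrs G I v) - 3) ≤ potential G (insert v I) := by
  have h1 := card_frontier_insert hv
  have h2 := card_degree_ne_two_insert hv
  have h3 := Finset.card_le_card (deadLeaves_subset_insert hv h)
  have h4 := Finset.card_filter_le (outsideNbrs G I v) (fun x => G.degree x ≠ 2)
  unfold potential
  omega

/-- If the only new vertex `x` has degree two, or some leaf dies, then the potential does not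
drop. -/
lemma potential_le_insert_of_eq_singleton (hv : v ∈ frontier G I) (h : outsideNbrs G I v = {x})
    (hx : G.degree x ≠ 2 → ∃ w ∈ deadLeaves G (insert v I), w ∉ deadLeaves G I) :
    potential G I ≤ potential G (insert v I) := by
  have h1 := card_frontier_insert hv
  have h2 := card_degree_ne_two_insert hv
  have hsub := deadLeaves_subset_insert hv (h ▸ Finset.singleton_nonempty x)
  rw [h] at h1 h2
  rw [Finset.card_singleton] at h1
  unfold potential
  by_cases hd : G.degree x = 2
  · have h3 := Finset.card_le_card hsub
    have h4 : #{y ∈ ({x} : Finset V) | G.degree y ≠ 2} = 0 := by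
      simp [Finset.filter_singleton, hd]
    omega
  · obtain ⟨w, hw, hw'⟩ := hx hd
    have h3 := Finset.card_lt_card (Finset.ssubset_iff_of_subset hsub |>.2 ⟨w, hw, hw'⟩)
    have h4 := Finset.card_filter_le ({x} : Finset V) (fun x => G.degree x ≠ 2)
    rw [Finset.card_singleton] at h4
    omega

/-- If every frontier vertex has at most one outside neighbour, then a new vertex `x` of degree
other than two with at most one neighbour outside either is dead itself or kills another leaf. -/
lemma exists_new_deadLeaf
    (hI : ∀ w ∈ frontier G I, #(outsideNbrs G I w) ≤ 1) (hv : v ∈ frontier G I)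
    (h : outsideNbrs G I v = {x}) (hx1 : #(outsideNbrs G I x) ≤ 1) (hx2 : G.degree x ≠ 2) :
    ∃ w ∈ deadLeaves G (insert v I), w ∉ deadLeaves G I := by
  have hvx : x ∈ outsideNbrs G I v := h ▸ Finset.mem_singleton_self x
  obtain ⟨hadj, hxU⟩ := mem_outsideNbrs.1 hvx
  by_cases hout : outsideNbrs G I x = ∅
  · refine ⟨x, ?_, fun hx => hxU (mem_frontier.1 (mem_deadLeaves.1 hx).1).1⟩
    rw [mem_deadLeaves, frontier_insert hv, outsideNbrs_insert hv, hout]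
    simp [hvx]
  · -- `x` has degree at least three, with at most one neighbour outside `N[I]`, so a second
    -- neighbour inside besides `v`.
    have hdeg : 3 ≤ G.degree x := by
      obtain ⟨y, hy⟩ := Finset.nonempty_iff_ne_empty.2 hout
      have hy' := mem_outsideNbrs.1 hy
      have : v ≠ y := by
        rintro rfl
        exact hy'.2 (mem_frontier.1 hv).1
      have : #({v, y} : Finset V) ≤ #(G.neighborFinset x) :=
        Finset.card_le_card (by
          intro z hz
          simp only [Finset.mem_insert, Finset.mem_singleton] at hz
          rcases hz with rfl | rfl
          · simpa using hadj.symm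
          · simpa using hy'.1)
      rw [Finset.card_pair ‹_›, card_neighborFinset_eq_degree] at this
      omega
    have hcard : 0 < #((G.neighborFinset x \ outsideNbrs G I x).erase v) := by
      have h1 := Finset.le_card_sdiff (outsideNbrs G I x) (G.neighborFinset x)
      have h2 := Finset.pred_card_le_card_erase
        (s := G.neighborFinset x \ outsideNbrs G I x) (a := v)
      rw [card_neighborFinset_eq_degree] at h1
      omega
    obtain ⟨w, hw⟩ := Finset.card_pos.1 hcard
    simp only [Finset.mem_erase, Finset.mem_sdiff, mem_neighborFinset, mem_outsideNbrs,
      not_and, not_not] at hw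
    obtain ⟨hwv, hxw, hwU⟩ := hw
    have hwI : w ∉ I := fun hwI => hxU (mem_closedNbhd.2 (.inr ⟨w, hwI, hxw.symm⟩))
    have hwF : w ∈ frontier G I := mem_frontier.2 ⟨hwU hxw, hwI⟩
    have hwx : x ∈ outsideNbrs G I w := mem_outsideNbrs.2 ⟨hxw.symm, hxU⟩
    refine ⟨w, ?_, fun hd => ?_⟩
    · rw [mem_deadLeaves, frontier_insert hv, outsideNbrs_insert hv, h]
      refine ⟨by simp [hwv, hwF], Finset.sdiff_eq_empty_iff_subset.2 fun y hy => ?_⟩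
      exact Finset.mem_singleton.2 (Finset.card_le_one.1 (hI w hwF) y hy x hwx)
    · simp [(mem_deadLeaves.1 hd).2] at hwx

lemma Connected.induce_insert (hI : (G.induce (I : Set V)).Connected) (hv : v ∈ frontier G I) :
    (G.induce (insert v I : Finset V)).Connected := by
  obtain ⟨hv1, hv2⟩ := mem_frontier.1 hv
  obtain ⟨a, ha, hadj⟩ := (mem_closedNbhd.1 hv1).resolve_left hv2
  have := induce_union_connected hI.preconnected
    (induce_pair_connected_of_adj hadj).preconnected ⟨a, by simpa using ha, by simp⟩
  convert this using 2
  all_goals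
    ext y
    simp only [Finset.coe_insert, Set.mem_insert_iff, Finset.mem_coe, Set.mem_union,
      Set.mem_singleton_iff]
    grind

lemma exists_frontier_outsideNbrs_nonempty (hG : G.Connected) (hI : I.Nonempty)
    (h : closedNbhd G I ≠ Finset.univ) : ∃ v ∈ frontier G I, (outsideNbrs G I v).Nonempty := by
  obtain ⟨r, hr⟩ := hI
  obtain ⟨y, hy⟩ : ∃ y, y ∉ closedNbhd G I := by
    by_contra! hcon
    exact h (Finset.eq_univ_of_forall hcon)
  obtain ⟨p⟩ := hG.preconnected r y
  obtain ⟨d, -, hd1, hd2⟩ := p.exists_boundary_dart (closedNbhd G I : Set V)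
    (by simpa using subset_closedNbhd hr) (by simpa using hy)
  have hmem : d.snd ∈ outsideNbrs G I d.fst := mem_outsideNbrs.2 ⟨d.adj, by simpa using hd2⟩
  refine ⟨d.fst, mem_frontier.2 ⟨by simpa using hd1, fun hdI => ?_⟩, _, hmem⟩
  simp [outsideNbrs_eq_empty_of_mem hdI] at hmem

lemma exists_ssuperset_potential_le (hG : G.Connected) (hI : (G.induce (I : Set V)).Connected)
    (h : closedNbhd G I ≠ Finset.univ) :
    ∃ J, I ⊂ J ∧ (G.induce (J : Set V)).Connected ∧ potential G I ≤ potential G J := by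
  have hne : I.Nonempty := by
    obtain ⟨⟨a, ha⟩⟩ := hI.nonempty
    exact ⟨a, ha⟩
  by_cases hbig : ∃ v ∈ frontier G I, 2 ≤ #(outsideNbrs G I v)
  · obtain ⟨v, hv, hv2⟩ := hbig
    have := potential_insert_ge hv (Finset.card_pos.1 (by omega))
    exact ⟨_, Finset.ssubset_insert (mem_frontier.1 hv).2, hI.induce_insert hv, by omega⟩
  have hsmall : ∀ w ∈ frontier G I, #(outsideNbrs G I w) ≤ 1 := fun w hw => by
    by_contra hc
    exact hbig ⟨w, hw, by omega⟩
  obtain ⟨v, hv, hvne⟩ := exists_frontier_outsideNbrs_nonempty hG hne h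
  obtain ⟨x, hx⟩ := Finset.card_eq_one.1 (le_antisymm (hsmall v hv) (Finset.card_pos.2 hvne))
  have hssub := Finset.ssubset_insert (mem_frontier.1 hv).2
  by_cases hx1 : #(outsideNbrs G I x) ≤ 1
  · exact ⟨_, hssub, hI.induce_insert hv, potential_le_insert_of_eq_singleton hv hx
      (exists_new_deadLeaf hsmall hv hx hx1)⟩
  · have hxF : x ∈ frontier G (insert v I) := by simp [frontier_insert hv, hx]
    have hxout : outsideNbrs G (insert v I) x = outsideNbrs G I x := by
      rw [outsideNbrs_insert hv, hx, Finset.sdiff_singleton_eq_erase, Finset.erase_eq_of_notMem]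
      exact fun hc => G.irrefl (mem_outsideNbrs.1 hc).1
    have h1 := potential_insert_ge hv hvne
    have h2 := potential_insert_ge hxF (Finset.card_pos.1 (by rw [hxout]; omega))
    rw [hx, Finset.card_singleton] at h1
    rw [hxout] at h2
    exact ⟨_, hssub.trans (Finset.ssubset_insert (mem_frontier.1 hxF).2),
      (hI.induce_insert hv).induce_insert hxF, by omega⟩

lemma exists_closedNbhd_eq_univ_potential_le (I : Finset V) (hG : G.Connected)
    (hI : (G.induce (I : Set V)).Connected) :
    ∃ J : Finset V, (G.induce (J : Set V)).Connected ∧ closedNbhd G J = Finset.univ ∧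
      potential G I ≤ potential G J := by
  by_cases h : closedNbhd G I = Finset.univ
  · exact ⟨I, hI, h, le_rfl⟩
  obtain ⟨J, hIJ, hJ, hle⟩ := exists_ssuperset_potential_le hG hI h
  have : #I < #J := Finset.card_lt_card hIJ
  have : #J ≤ Fintype.card V := Finset.card_le_univ J
  obtain ⟨K, hK, hKu, hle'⟩ := exists_closedNbhd_eq_univ_potential_le J hG hJ
  exact ⟨K, hK, hKu, hle.trans hle'⟩
termination_by Fintype.card V - #I

lemma potential_singleton_ge (r : V) : 2 * (G.degree r : ℤ) - 1 ≤ potential G {r} := by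
  have hU : closedNbhd G {r} = insert r (G.neighborFinset r) := by
    ext x
    simp [mem_closedNbhd]
  have hF : frontier G {r} = G.neighborFinset r := by
    ext x
    rw [mem_frontier, hU]
    simp only [Finset.mem_insert, mem_neighborFinset, Finset.mem_singleton]
    exact ⟨fun h => h.1.resolve_left h.2, fun h => ⟨.inr h, h.ne'⟩⟩
  have h1 := Finset.card_filter_le (closedNbhd G {r}) (fun x => G.degree x ≠ 2)
  have h2 : #(closedNbhd G {r}) ≤ G.degree r + 1 := by
    rw [hU, ← card_neighborFinset_eq_degree]
    exact Finset.card_insert_le _ _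
  have h3 : #(frontier G {r}) = G.degree r := by rw [hF, card_neighborFinset_eq_degree]
  unfold potential
  omega

lemma potential_eq_of_closedNbhd_eq_univ (h : closedNbhd G I = Finset.univ) :
    potential G I = 4 * #Iᶜ - numDegNeTwo G := by
  have hF : frontier G I = Iᶜ := by rw [frontier, h, Finset.compl_eq_univ_sdiff]
  have hD : deadLeaves G I = Iᶜ := by
    ext x
    simp [mem_deadLeaves, hF, outsideNbrs, h]
  rw [potential, hF, hD, h, numDegNeTwo]
  ring

/-! ### From a connected dominating set to a spanning tree -/

/-- If `I` is connected and dominating, then some spanning tree has all vertices outside `I` as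
leaves. It is any spanning tree of the subgraph that keeps the edges inside `I` and joins every
other vertex to a single neighbour in `I`. -/
lemma exists_isSpanningTree_card_compl_le [Nontrivial V] (hI : (G.induce (I : Set V)).Connected)
    (h : closedNbhd G I = Finset.univ) :
    ∃ T : SimpleGraph V, IsSpanningTree T G ∧ #Iᶜ ≤ numLeaves T := by
  have hp : ∀ v, ∃ a, v ∉ I → a ∈ I ∧ G.Adj a v := fun v => by
    by_cases hv : v ∈ I
    · exact ⟨v, fun h => absurd hv h⟩
    · obtain ⟨a, ha⟩ := (mem_closedNbhd.1 (h ▸ Finset.mem_univ v)).resolve_left hv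
      exact ⟨a, fun _ => ha⟩
  choose p hp using hp
  let H : SimpleGraph V :=
    { Adj := fun a b => G.Adj a b ∧
        ((a ∈ I ∧ b ∈ I) ∨ (a ∉ I ∧ b = p a) ∨ (b ∉ I ∧ a = p b))
      symm := ⟨fun a b hab => ⟨hab.1.symm, by tauto⟩⟩
      loopless := ⟨fun a ha => G.irrefl ha.1⟩ }
  have hHG : H ≤ G := fun a b hab => hab.1
  have hreach : ∀ a ∈ I, ∀ b ∈ I, H.Reachable a b := fun a ha b hb =>
    (hI.preconnected ⟨a, ha⟩ ⟨b, hb⟩).map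
      (⟨Subtype.val, fun {x y} hxy => ⟨hxy, .inl ⟨x.2, y.2⟩⟩⟩ : G.induce (I : Set V) →g H)
  have hH : H.Connected := by
    obtain ⟨⟨r, hr⟩⟩ := hI.nonempty
    refine connected_iff_exists_forall_reachable _ |>.2 ⟨r, fun w => ?_⟩
    by_cases hw : w ∈ I
    · exact hreach r hr w hw
    · obtain ⟨h1, h2⟩ := hp w hw
      have : H.Adj (p w) w := ⟨h2, .inr (.inr ⟨hw, rfl⟩)⟩
      exact (hreach r hr _ h1).trans this.reachable
  obtain ⟨T, hTH, hT⟩ := hH.exists_isTree_le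
  refine ⟨T, ⟨hTH.trans hHG, hT⟩, Finset.card_le_card fun v hv => ?_⟩
  have hv : v ∉ I := by simpa using hv
  have hsub : T.neighborFinset v ⊆ {p v} := fun w hw => by
    obtain ⟨-, h | h | h⟩ := hTH ((T.mem_neighborFinset v w).1 hw)
    · exact absurd h.1 hv
    · simpa using h.2
    · exact absurd (h.2 ▸ (hp w h.1).1) hv
  have hle := Finset.card_le_card hsub
  rw [card_neighborFinset_eq_degree, Finset.card_singleton] at hle
  have hpos := hT.connected.preconnected.degree_pos_of_nontrivial v
  simp only [Finset.mem_filter, Finset.mem_univ, true_and]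
  omega

/-! ### The three ranges of the maximum degree -/

/-- Growing from a vertex of degree `d` yields at least `(s + 2 * d - 1) / 4` leaves. -/
lemma exists_isSpanningTree_of_degree [Nontrivial V] (hG : G.Connected) (r : V) :
    ∃ T : SimpleGraph V, IsSpanningTree T G ∧
      numDegNeTwo G + 2 * G.degree r ≤ 4 * numLeaves T + 1 := by
  have hr : (G.induce (({r} : Finset V) : Set V)).Connected := by
    rw [Finset.coe_singleton]
    exact ⟨.of_subsingleton⟩
  obtain ⟨J, hJ, hU, hle⟩ := exists_closedNbhd_eq_univ_potential_le _ hG hr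
  obtain ⟨T, hT, hcard⟩ := exists_isSpanningTree_card_compl_le hJ hU
  have h1 := potential_singleton_ge (G := G) r
  rw [potential_eq_of_closedNbhd_eq_univ hU] at hle
  exact ⟨T, hT, by omega⟩

lemma even_numDegNeTwo [Nontrivial V] (hG : G.Connected) (h : ∀ v, G.degree v ≤ 3) :
    Even (numDegNeTwo G) := by
  have := G.even_card_odd_degree_vertices
  rw [numDegNeTwo]
  convert this using 2
  ext v
  have h1 := hG.preconnected.degree_pos_of_nontrivial v
  have h2 := h v
  simp only [Finset.mem_filter, Finset.mem_univ, true_and]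
  interval_cases G.degree v <;> decide

lemma numDegNeTwo_le_two [Nontrivial V] (hG : G.Connected) (h : ∀ v, G.degree v ≤ 2) :
    numDegNeTwo G ≤ 2 := by
  have hedge := hG.card_vert_le_card_edgeSet_add_one
  rw [Nat.card_eq_fintype_card, Nat.card_eq_fintype_card, ← edgeFinset_card] at hedge
  have hsum := G.sum_degrees_eq_twice_card_edges
  have hle : ∑ v, G.degree v + numDegNeTwo G ≤ ∑ _v : V, 2 := by
    rw [numDegNeTwo, Finset.card_filter, ← Finset.sum_add_distrib]
    refine Finset.sum_le_sum fun v _ => ?_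
    have := h v
    split_ifs <;> omega
  rw [Finset.sum_const, Finset.card_univ, smul_eq_mul] at hle
  omega

lemma two_le_numLeaves [Nontrivial V] {T : SimpleGraph V} (hT : T.IsTree) : 2 ≤ numLeaves T := by
  obtain ⟨u, v, huv, hu, hv⟩ := hT.exists_ne_and_degree_eq_one
  exact Finset.one_lt_card.2 ⟨u, by simpa using hu, v, by simpa using hv, huv⟩

lemma exists_isSpanningTree_numDegNeTwo_add_six_le [Nontrivial V] (hG : G.Connected) :
    ∃ T : SimpleGraph V, IsSpanningTree T G ∧ numDegNeTwo G + 6 ≤ 4 * numLeaves T := by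
  by_cases h4 : ∃ r, 4 ≤ G.degree r
  · obtain ⟨r, hr⟩ := h4
    obtain ⟨T, hT, hle⟩ := exists_isSpanningTree_of_degree hG r
    exact ⟨T, hT, by omega⟩
  push Not at h4
  by_cases h3 : ∃ r, 3 ≤ G.degree r
  · obtain ⟨r, hr⟩ := h3
    obtain ⟨T, hT, hle⟩ := exists_isSpanningTree_of_degree hG r
    obtain ⟨k, hk⟩ := even_numDegNeTwo hG fun v => Nat.le_of_lt_succ (h4 v)
    exact ⟨T, hT, by omega⟩
  push Not at h3
  obtain ⟨T, hTG, hT⟩ := hG.exists_isTree_le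
  have h1 := numDegNeTwo_le_two hG fun v => Nat.le_of_lt_succ (h3 v)
  have h2 := two_le_numLeaves hT
  exact ⟨T, ⟨hTG, hT⟩, by omega⟩

end Potential

end SimpleGraph

theorem theorem1 {V : Type*} [Fintype V] (G : SimpleGraph V) (hG : G.Connected)
    (hV : 2 ≤ Fintype.card V) :
    ∃ T : SimpleGraph V, IsSpanningTree T G ∧
      ((numDegNeTwo G : ℝ) - 2) / 4 + 2 ≤ (numLeaves T : ℝ) := by
  have : Nontrivial V := Fintype.one_lt_card_iff_nontrivial.1 hV
  obtain ⟨T, hT, hle⟩ := SimpleGraph.exists_isSpanningTree_numDegNeTwo_add_six_le hG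
  have hle' : (numDegNeTwo G : ℝ) + 6 ≤ 4 * numLeaves T := by exact_mod_cast hle
  exact ⟨T, hT, by linarith⟩
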